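/- For $z\in\mathbb{C}$ let $\varphi(z)=\frac1{\sqrt{2\pi}}e^{-z^2/2}$ and $\Psi(z)=\int_z^{\infty+0i}\varphi(w)\,dw$, so that $\Psi$ is an entire function and $\Psi(x)=\int_x^\infty\varphi(u)\,du$ is the tail function of the standard normal distribution for real $x$. Let $R=\varphi/\Psi$ and $H_+=\{z\in\mathbb{C}:\operatorname{Re}z\ge0\}$. (I) $\Psi$ has no zeros on $H_+$. Hence the function $S(z)=\dfrac{R(z)}{z+\sqrt{2/\pi}}$ is well defined on $H_+$ (its denominators do not vanish there), and it is holomorphic on the interior of $H_+$. (II) The function $y\mapsto|S(iy)|$ has exactly one minimizer $y_*$ on $(0,\infty)$. Moreover $1.6267\le y_*<1.6268$, $0.686\le|S(iy_*)|<0.687$, and $$1>|S(z)|>|S(iy_*)|\quad\text{for all }z\in H_+\setminus\{0,iy_*,-iy_*\}.$$ (III) Both bounds are exact: on $H_+\setminus\{0,iy_*,-iy_*\}$ the infimum of $|S|$ is $|S(iy_*)|$ and its supremum is $1$; moreover $S(0)=1$, and $S(z)\to1$ as $z\to\infty$ within $H_+$. -/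

import Mathlib

noncomputable section

namespace InvMills

/-- The standard normal density, as an entire function on `ℂ`. -/
def phi (z : ℂ) : ℂ :=
  ((1 / Real.sqrt (2 * Real.pi) : ℝ) : ℂ) * Complex.exp (-z ^ 2 / 2)

/-- The standard normal tail function on `ℂ`, i.e. the contour integral of `phi` from `z` to
`∞ + 0i`. The contour is the segment from `z` to `0`, which contributes
`-∫ t in 0..1, phi (t * z) * z`, followed by the half-line `[0, ∞)` of the real axis. -/
def Psi (z : ℂ) : ℂ :=
  (∫ u in Set.Ioi (0 : ℝ), phi (u : ℂ)) - ∫ t in (0 : ℝ)..1, phi ((t : ℂ) * z) * z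

/-- The inverse Mills ratio. -/
def R (z : ℂ) : ℂ := phi z / Psi z

/-- The function `S(z) = R(z) / (z + √(2/π))`, used on the closed right half-plane only. -/
def S (z : ℂ) : ℂ := R z / (z + (Real.sqrt (2 / Real.pi) : ℂ))

/-- The closed right half-plane. -/
def Hplus : Set ℂ := {z : ℂ | 0 ≤ z.re}

end InvMills

end

/-! ### Lower bounds for the imaginary error function. -/

noncomputable section

namespace InvMills

open Real Set Filter Topology

/-! Write M = `moment 0` for the Mills ratio Ψ/φ, F = `expInt`, c = √(2/π) and m = `critSq` = 1 -
2/π, so that 1/S = (z + c) M.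

Integration by parts gives M' = zM - 1, and also M → 0 and zM → 1 at infinity in the closed
half-plane, so 1/S → 1 (`tendsto_recipS`). On the imaginary axis the differential equation
integrates to e^{y²/2} M(iy) = √(π/2) - iF(y) (`exp_mul_moment_I`). Hence Re M > 0 there, and the
maximum principle for e^{-M} carries this to the whole half-plane: Ψ has no zeros
(`moment_zero_re_pos`).

Now S and 1/S are both holomorphic with limit 1 at infinity, so Phragmén-Lindelöf
(`norm_lt_of_pos_re`), applied to each, reduces both strict bounds to the imaginary axis. There
|1/S|² = `sqMod` equals 1 at 0 and tends to 1 at infinity, so one peak in between is all that is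
needed. For y > √m its derivative has the sign of `slope`, which decreases strictly by the sharp
bound `expInt_gt`; numerical enclosures at 1.6267 and 1.6268 locate the zero
(`exists_slope_eq_zero`). -/

/-- The unnormalised imaginary error function `∫₀^y exp (t²/2) dt`. -/
def expInt (y : ℝ) : ℝ := ∫ t in (0 : ℝ)..y, exp (t ^ 2 / 2)

lemma expInt_zero : expInt 0 = 0 := by simp [expInt]

lemma hasDerivAt_expInt (y : ℝ) : HasDerivAt expInt (exp (y ^ 2 / 2)) y := by
  have hc : Continuous fun t : ℝ => exp (t ^ 2 / 2) := by fun_prop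
  exact intervalIntegral.integral_hasDerivAt_right (hc.intervalIntegrable _ _)
    hc.stronglyMeasurable.stronglyMeasurableAtFilter hc.continuousAt

lemma hasDerivAt_exp_sq_half (y : ℝ) :
    HasDerivAt (fun t : ℝ => exp (t ^ 2 / 2)) (exp (y ^ 2 / 2) * y) y := by
  have h : HasDerivAt (fun t : ℝ => t ^ 2 / 2) y y := by
    refine HasDerivAt.congr_deriv (((hasDerivAt_id' y).fun_pow 2).div_const 2) ?_
    simp
  exact h.exp

lemma continuous_expInt : Continuous expInt :=
  continuous_iff_continuousAt.2 fun y => (hasDerivAt_expInt y).continuousAt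

lemma expInt_strictMono : StrictMono expInt :=
  strictMono_of_hasDerivAt_pos hasDerivAt_expInt fun _ => exp_pos _

lemma expInt_pos {y : ℝ} (hy : 0 < y) : 0 < expInt y := by
  simpa [expInt_zero] using expInt_strictMono hy

lemma expInt_neg (y : ℝ) : expInt (-y) = -expInt y := by
  unfold expInt
  have h := intervalIntegral.integral_comp_neg (a := 0) (b := y) (fun t : ℝ => exp (t ^ 2 / 2))
  simp only [neg_sq, neg_zero] at h
  rw [h, intervalIntegral.integral_symm]

/-- A rational lower bound for `expInt`. -/
lemma le_expInt {y : ℝ} (hy : 0 ≤ y) :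
    y * (y ^ 2 + 3) / (y ^ 4 + 2 * y ^ 2 + 3) * exp (y ^ 2 / 2) ≤ expInt y := by
  set f : ℝ → ℝ := fun y =>
    expInt y - y * (y ^ 2 + 3) / (y ^ 4 + 2 * y ^ 2 + 3) * exp (y ^ 2 / 2) with hf
  -- The rational factor is the continued-fraction convergent y/(1 + y² - 2y²/(3 + y²)) of e^{-y²/2}
  -- F(y); the error has a manifestly nonnegative derivative.
  have hd : ∀ x, HasDerivAt f
      (exp (x ^ 2 / 2) * (8 * x ^ 4 / (x ^ 4 + 2 * x ^ 2 + 3) ^ 2)) x := by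
    intro x
    have hK : x ^ 4 + 2 * x ^ 2 + 3 ≠ 0 := by positivity
    have h1 : HasDerivAt (fun y : ℝ => y * (y ^ 2 + 3)) (3 * x ^ 2 + 3) x := by
      refine HasDerivAt.congr_deriv
        ((hasDerivAt_id' x).fun_mul (((hasDerivAt_id' x).fun_pow 2).add_const 3)) ?_
      simp; ring
    have h2 : HasDerivAt (fun y : ℝ => y ^ 4 + 2 * y ^ 2 + 3) (4 * x ^ 3 + 4 * x) x := by
      refine HasDerivAt.congr_deriv
        ((((hasDerivAt_id' x).fun_pow 4).fun_add
          (((hasDerivAt_id' x).fun_pow 2).const_mul 2)).add_const 3) ?_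
      simp; ring
    refine HasDerivAt.congr_deriv
      ((hasDerivAt_expInt x).fun_sub ((h1.fun_div h2 hK).fun_mul (hasDerivAt_exp_sq_half x))) ?_
    field_simp
    ring
  have hm : Monotone f := monotone_of_hasDerivAt_nonneg hd fun x => by
    simp only [Pi.zero_apply]; positivity
  have := hm hy
  simp only [hf, expInt_zero] at this
  simp at this
  linarith

lemma hasDerivAt_sq_sub (m y : ℝ) : HasDerivAt (fun t : ℝ => t ^ 2 - m) (2 * y) y := by
  refine HasDerivAt.congr_deriv (((hasDerivAt_id' y).fun_pow 2).sub_const m) ?_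
  simp

/-- The denominator polynomial of the comparison function for `expInt`. -/
def cubic (m w : ℝ) : ℝ := w ^ 3 + m * w ^ 2 + (3 - m) * w + 2 * m

lemma cubic_pos {m w : ℝ} (h1 : 0.363 < m) (h2 : m < 0.364) (hw : 0 < w) : 0 < cubic m w := by
  unfold cubic
  have : 0 < 3 - m := by linarith
  have : 0 < m := by linarith
  positivity

/-- For small y the bound of `le_expInt` is already stronger, which is a polynomial inequality in w
= y² - m. -/
lemma expInt_gt_of_sq_le_two {m y : ℝ} (h1 : 0.363 < m) (h2 : m < 0.364) (hy : 0 < y)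
    (hw : 0 < y ^ 2 - m) (hy2 : y ^ 2 ≤ 2) :
    y * (y ^ 2 - m) * (y ^ 2 - m + 1) / cubic m (y ^ 2 - m) * exp (y ^ 2 / 2) < expInt y := by
  refine lt_of_lt_of_le ?_ (le_expInt hy.le)
  refine mul_lt_mul_of_pos_right ?_ (exp_pos _)
  have hT := cubic_pos h1 h2 hw
  rw [div_lt_div_iff₀ hT (by positivity)]
  obtain ⟨w, hww⟩ : ∃ w, w = y ^ 2 - m := ⟨_, rfl⟩
  have e : y ^ 4 + 2 * y ^ 2 + 3 = (w + m) ^ 2 + 2 * (w + m) + 3 := by rw [hww]; ring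
  have e2 : y ^ 2 = w + m := by rw [hww]; ring
  rw [e, e2]
  rw [e2] at hw hy2
  have hw' : 0 < w := by linarith
  have : w * (w + 1) * ((w + m) ^ 2 + 2 * (w + m) + 3) < (w + m + 3) * cubic m w := by
    unfold cubic
    have q : 0 < m := by linarith
    nlinarith [mul_pos hw' q, mul_pos hw' hw', mul_pos (mul_pos hw' hw') hw',
      mul_pos (mul_pos hw' hw') q,
      mul_nonneg hw'.le (mul_nonneg hw'.le (by linarith : 0 ≤ 2 - m - w)),
      mul_nonneg hw'.le (by linarith : 0 ≤ 2 - m - w)]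
  have := mul_lt_mul_of_pos_left this hy
  have e3 : w + m - m = w := by ring
  rw [e3]
  linarith

/-- This is precisely the inequality that makes the derivative of `slope` negative. Beyond y² = 2
the left side minus F is nonincreasing: the quadratic factor of its derivative changes sign near y²
= 1.98, which dictates where to split. -/
lemma expInt_gt {m y : ℝ} (h1 : 0.363 < m) (h2 : m < 0.364) (hy : 0 < y)
    (hw : 0 < y ^ 2 - m) :
    y * (y ^ 2 - m) * (y ^ 2 - m + 1) / cubic m (y ^ 2 - m) * exp (y ^ 2 / 2) < expInt y := by
  rcases le_total (y ^ 2) 2 with h | h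
  · exact expInt_gt_of_sq_le_two h1 h2 hy hw h
  set f : ℝ → ℝ := fun y =>
    y * (y ^ 2 - m) * (y ^ 2 - m + 1) / cubic m (y ^ 2 - m) * exp (y ^ 2 / 2) - expInt y with hf
  have hd : ∀ x, 0 < x ^ 2 - m → HasDerivAt f
      (exp (x ^ 2 / 2) * (2 * x ^ 2 * (x ^ 2 - m) * ((m - 3) * (x ^ 2 - m) ^ 2
        + (6 - 4 * m) * (x ^ 2 - m) + (7 * m - 3)) / cubic m (x ^ 2 - m) ^ 2)) x := by
    intro x hx
    have hK := (cubic_pos h1 h2 hx).ne'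
    have ha := hasDerivAt_sq_sub m x
    have hb : HasDerivAt (fun y : ℝ => cubic m (y ^ 2 - m))
        ((3 * (x ^ 2 - m) ^ 2 + 2 * m * (x ^ 2 - m) + (3 - m)) * (2 * x)) x := by
      unfold cubic
      refine HasDerivAt.congr_deriv
        ((((ha.fun_pow 3).fun_add ((ha.fun_pow 2).const_mul m)).fun_add
          (ha.const_mul (3 - m))).add_const
        (2 * m)) ?_
      simp; ring
    have hc := ((((hasDerivAt_id' x).fun_mul ha).fun_mul (ha.add_const 1)).fun_div hb hK).fun_mul
      (hasDerivAt_exp_sq_half x)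
    refine HasDerivAt.congr_deriv (hc.fun_sub (hasDerivAt_expInt x)) ?_
    field_simp
    unfold cubic
    ring
  have hsq : √2 ^ 2 = 2 := Real.sq_sqrt (by norm_num)
  have hge : ∀ x ∈ Ici (√2), 2 ≤ x ^ 2 := fun x hx => by
    rw [← hsq]; exact pow_le_pow_left₀ (sqrt_nonneg 2) hx 2
  have hanti : AntitoneOn f (Ici (√2)) := by
    refine antitoneOn_of_hasDerivWithinAt_nonpos (convex_Ici _)
      (fun x hx => (hd x (by linarith [hge x hx])).continuousAt.continuousWithinAt)
      (fun x hx => (hd x (by linarith [hge x (interior_subset hx)])).hasDerivWithinAt) ?_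
    intro x hx
    have hx2 := hge x (interior_subset hx)
    have hK := cubic_pos h1 h2 (by linarith : 0 < x ^ 2 - m)
    have hneg : (m - 3) * (x ^ 2 - m) ^ 2 + (6 - 4 * m) * (x ^ 2 - m) + (7 * m - 3) ≤ 0 := by
      nlinarith [mul_nonneg (by linarith : 0 ≤ 3 - m) (by linarith : 0 ≤ x ^ 2 - 2)]
    refine mul_nonpos_of_nonneg_of_nonpos (exp_pos _).le
      (div_nonpos_of_nonpos_of_nonneg (mul_nonpos_of_nonneg_of_nonpos ?_ hneg) (by positivity))
    have : 0 ≤ x ^ 2 - m := by linarith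
    positivity
  have hy2 : √2 ≤ y := Real.sqrt_le_iff.2 ⟨hy.le, h⟩
  have h3 := hanti (self_mem_Ici) hy2 hy2
  have h4 := expInt_gt_of_sq_le_two h1 h2 (y := √2) (by positivity) (by linarith) hsq.le
  simp only [hf] at h3
  linarith

/-! ### Unimodality of the modulus on the imaginary axis. -/

/-- The function whose sign is that of the derivative of the squared modulus of `1 / S` along the
imaginary axis. -/
def slope (m y : ℝ) : ℝ :=
  (y ^ 2 - m + 1) / (y * (y ^ 2 - m)) * expInt y * exp (y ^ 2 / 2) - (1 / (1 - m) + expInt y ^ 2)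

/-- Since F² enters `slope` with the constant coefficient -1, differentiating leaves e^{x²/2} times
an expression linear in F, whose sign is settled by `expInt_gt`. -/
lemma slope_strictAntiOn {m : ℝ} (h1 : 0.363 < m) (h2 : m < 0.364) :
    StrictAntiOn (slope m) (Ioi (√m)) := by
  have hm : 0 < m := by linarith
  have hpos : ∀ x ∈ Ioi (√m), 0 < x ∧ 0 < x ^ 2 - m := fun x hx => by
    have h0 : 0 < x := (Real.sqrt_nonneg m).trans_lt hx
    exact ⟨h0, by linarith [(Real.sqrt_lt' h0).1 hx]⟩
  have hd : ∀ x ∈ Ioi (√m), HasDerivAt (slope m)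
      (exp (x ^ 2 / 2) * (cubic m (x ^ 2 - m) / (x ^ 2 * (x ^ 2 - m) ^ 2)) *
        (x * (x ^ 2 - m) * (x ^ 2 - m + 1) / cubic m (x ^ 2 - m) * exp (x ^ 2 / 2)
          - expInt x)) x := by
    intro x hx
    obtain ⟨hx0, hxm⟩ := hpos x hx
    have hK := (cubic_pos h1 h2 hxm).ne'
    have ha := hasDerivAt_sq_sub m x
    have hb := (((((ha.add_const 1).fun_div ((hasDerivAt_id' x).fun_mul ha)
      (mul_pos hx0 hxm).ne').fun_mul (hasDerivAt_expInt x)).fun_mul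
        (hasDerivAt_exp_sq_half x))).fun_sub
      (((hasDerivAt_expInt x).fun_pow 2).const_add (1 / (1 - m)))
    refine HasDerivAt.congr_deriv (hb) ?_
    have := hxm.ne'
    field_simp
    unfold cubic
    ring
  refine strictAntiOn_of_hasDerivWithinAt_neg (convex_Ioi _)
    (fun x hx => (hd x hx).continuousAt.continuousWithinAt)
    (fun x hx => (hd x (interior_subset hx)).hasDerivWithinAt) ?_
  intro x hx
  obtain ⟨hx0, hxm⟩ := hpos x (interior_subset hx)
  have hK := cubic_pos h1 h2 hxm
  refine mul_neg_of_pos_of_neg (by positivity) ?_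
  linarith [expInt_gt h1 h2 hx0 hxm]

/-- The squared modulus of `1 / S` at `i y`, with `m = 1 - 2 / π`. -/
def sqMod (m y : ℝ) : ℝ := (y ^ 2 - m + 1) * exp (-y ^ 2) * (1 / (1 - m) + expInt y ^ 2)

lemma hasDerivAt_sqMod (m y : ℝ) : HasDerivAt (sqMod m)
    (2 * exp (-y ^ 2) * ((y ^ 2 - m + 1) * expInt y * exp (y ^ 2 / 2)
      - y * (y ^ 2 - m) * (1 / (1 - m) + expInt y ^ 2))) y := by
  have ha := hasDerivAt_sq_sub m y
  have hb : HasDerivAt (fun t : ℝ => exp (-t ^ 2)) (exp (-y ^ 2) * (-(2 * y))) y := by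
    have : HasDerivAt (fun t : ℝ => -t ^ 2) (-(2 * y)) y := by
      simpa using ((hasDerivAt_id' y).fun_pow 2).fun_neg
    exact this.exp
  refine HasDerivAt.congr_deriv (((ha.add_const 1).fun_mul hb).fun_mul
    (((hasDerivAt_expInt y).fun_pow 2).const_add (1 / (1 - m)))) ?_
  push_cast
  ring

lemma continuous_sqMod (m : ℝ) : Continuous (sqMod m) :=
  continuous_iff_continuousAt.2 fun y => (hasDerivAt_sqMod m y).continuousAt

lemma sqMod_neg (m y : ℝ) : sqMod m (-y) = sqMod m y := by
  simp [sqMod, expInt_neg]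

lemma sqMod_zero {m : ℝ} (hm : m < 1) : sqMod m 0 = 1 := by
  have : 1 - m ≠ 0 := by linarith
  simp only [sqMod, expInt_zero]
  norm_num
  field_simp
  ring

lemma sqMod_deriv_eq {m y : ℝ} (hy : 0 < y) (hw : 0 < y ^ 2 - m) :
    (y ^ 2 - m + 1) * expInt y * exp (y ^ 2 / 2) - y * (y ^ 2 - m) * (1 / (1 - m) + expInt y ^ 2)
      = y * (y ^ 2 - m) * slope m y := by
  have := hw.ne'
  unfold slope
  generalize 1 / (1 - m) = a
  field_simp

/-- The squared modulus is unimodal, with its peak at the zero of `slope`. -/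
lemma sqMod_unimodal {m y₀ : ℝ} (h1 : 0.363 < m) (h2 : m < 0.364) (hy₀ : √m < y₀)
    (h0 : slope m y₀ = 0) :
    StrictMonoOn (sqMod m) (Icc 0 y₀) ∧ StrictAntiOn (sqMod m) (Ici y₀) := by
  have hm : 0 < m := by linarith
  have hy0 : 0 < y₀ := (Real.sqrt_nonneg m).trans_lt hy₀
  constructor
  · refine strictMonoOn_of_hasDerivWithinAt_pos (convex_Icc _ _)
      (continuous_sqMod m).continuousOn (fun x _ => (hasDerivAt_sqMod m x).hasDerivWithinAt) ?_
    intro x hx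
    rw [interior_Icc] at hx
    have hF := expInt_pos hx.1
    refine mul_pos (by positivity) ?_
    -- Up to √m both terms of the derivative are favourable; only beyond it is `slope` needed.
    rcases le_or_gt (x ^ 2) m with h | h
    · have q1 : 0 < x ^ 2 - m + 1 := by nlinarith [sq_nonneg x]
      have q2 : 0 ≤ x * (m - x ^ 2) := mul_nonneg hx.1.le (by linarith)
      have q3 : 0 < 1 / (1 - m) + expInt x ^ 2 := by
        have : 0 < 1 - m := by linarith
        positivity
      have := mul_pos (mul_pos q1 hF) (exp_pos (x ^ 2 / 2))
      nlinarith [mul_nonneg q2 q3.le]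
    · rw [sqMod_deriv_eq hx.1 (by linarith)]
      have hxm : √m < x := (Real.sqrt_lt' hx.1).2 h
      have := slope_strictAntiOn h1 h2 hxm hy₀ hx.2
      exact mul_pos (mul_pos hx.1 (by linarith)) (by linarith)
  · refine strictAntiOn_of_hasDerivWithinAt_neg (convex_Ici _)
      (continuous_sqMod m).continuousOn (fun x _ => (hasDerivAt_sqMod m x).hasDerivWithinAt) ?_
    intro x hx
    rw [interior_Ici] at hx
    have hx0 : 0 < x := hy0.trans hx
    have hxm : √m < x := hy₀.trans hx
    have h : m < x ^ 2 := (Real.sqrt_lt' hx0).1 hxm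
    refine mul_neg_of_pos_of_neg (by positivity) ?_
    rw [sqMod_deriv_eq hx0 (by linarith)]
    have := slope_strictAntiOn h1 h2 hy₀ hxm hx
    exact mul_neg_of_pos_of_neg (mul_pos hx0 (by linarith)) (by linarith)

/-! ### Numerical location of the peak. -/

lemma abs_exp_sq_half_sub_le {t : ℝ} (ht : t ∈ Icc (0 : ℝ) 1.627) :
    |exp (t ^ 2 / 2) - ∑ n ∈ Finset.range 14, (t ^ 2 / 2) ^ n / n.factorial| ≤ 1e-8 := by
  have hx0 : 0 ≤ t ^ 2 / 2 := by positivity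
  -- 1.3236 is 1.627²/2 rounded up.
  have hx1 : t ^ 2 / 2 ≤ 1.3236 := by nlinarith [ht.1, ht.2]
  have hn : ‖((t ^ 2 / 2 : ℝ) : ℂ)‖ = t ^ 2 / 2 := by
    rw [Complex.norm_real, Real.norm_of_nonneg hx0]
  have h := Complex.exp_bound' (x := ((t ^ 2 / 2 : ℝ) : ℂ)) (n := 14) (by
    rw [hn]; norm_num at hx1 ⊢; linarith)
  rw [hn] at h
  have h' : ‖((exp (t ^ 2 / 2) - ∑ n ∈ Finset.range 14, (t ^ 2 / 2) ^ n / n.factorial : ℝ) : ℂ)‖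
      ≤ (t ^ 2 / 2) ^ 14 / Nat.factorial 14 * 2 := by
    push_cast at h ⊢
    exact h
  rw [Complex.norm_real, Real.norm_eq_abs] at h'
  refine h'.trans ?_
  have := pow_le_pow_left₀ hx0 hx1 14
  have h3 : ((1.3236 : ℝ)) ^ 14 / Nat.factorial 14 * 2 ≤ 1e-8 := by
    norm_num [Nat.factorial]
  refine le_trans ?_ h3
  gcongr

/-- Termwise integration of the Taylor polynomial; the error is at most 1.627 · 1e-8. -/
lemma abs_expInt_sub_le {y : ℝ} (hy : y ∈ Icc (0 : ℝ) 1.627) :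
    |expInt y - ∑ n ∈ Finset.range 14, y ^ (2 * n + 1) / (2 ^ n * n.factorial * (2 * n + 1))|
      ≤ 2e-8 := by
  have hsum : ∑ n ∈ Finset.range 14, y ^ (2 * n + 1) / (2 ^ n * n.factorial * (2 * n + 1))
      = ∫ t in (0 : ℝ)..y, ∑ n ∈ Finset.range 14, (t ^ 2 / 2) ^ n / n.factorial := by
    rw [intervalIntegral.integral_finsetSum
      fun n _ => Continuous.intervalIntegrable (by fun_prop) _ _]
    refine Finset.sum_congr rfl fun n _ => ?_
    have : ∀ t : ℝ, (t ^ 2 / 2) ^ n / n.factorial = (1 / (2 ^ n * n.factorial)) * t ^ (2 * n) := by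
      intro t; rw [div_pow, pow_mul]; field_simp
    simp_rw [this]
    rw [intervalIntegral.integral_const_mul, integral_pow]
    have : ((2 * n : ℕ) : ℝ) + 1 ≠ 0 := by positivity
    push_cast at this ⊢
    simp
    field_simp
  rw [hsum, expInt, ← intervalIntegral.integral_sub
    (Continuous.intervalIntegrable (by fun_prop) _ _)
    (Continuous.intervalIntegrable (by fun_prop) _ _)]
  have := intervalIntegral.norm_integral_le_of_norm_le_const (a := 0) (b := y) (C := 1e-8)
    (f := fun t : ℝ => exp (t ^ 2 / 2) - ∑ n ∈ Finset.range 14, (t ^ 2 / 2) ^ n / n.factorial)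
    (fun t ht => by
      rw [uIoc_of_le hy.1] at ht
      exact abs_exp_sq_half_sub_le ⟨ht.1.le, ht.2.trans hy.2⟩)
  rw [Real.norm_eq_abs, sub_zero, abs_of_nonneg hy.1] at this
  refine this.trans ?_
  have := hy.2
  norm_num at this ⊢
  linarith

/-- The constant `1 - 2 / π`. -/
def critSq : ℝ := 1 - 2 / π

lemma critSq_bounds : 0.3633802 < critSq ∧ critSq < 0.3633803 := by
  have h1 := Real.pi_gt_d20
  have h2 := Real.pi_lt_d20
  have hp := Real.pi_pos
  unfold critSq
  constructor
  · have : 2 / π < 0.6366198 := by rw [div_lt_iff₀ hp]; norm_num at *; linarith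
    norm_num at *; linarith
  · have : 0.6366197 < 2 / π := by rw [lt_div_iff₀ hp]; norm_num at *; linarith
    norm_num at *; linarith

lemma one_div_one_sub_critSq : 1 / (1 - critSq) = π / 2 := by
  simp [critSq]

lemma expInt_bounds_left : 2.747764 < expInt 1.6267 ∧ expInt 1.6267 < 2.7477642 := by
  have h := abs_le.1 (abs_expInt_sub_le (y := 1.6267) (by constructor <;> norm_num))
  norm_num [Finset.sum_range_succ, Nat.factorial] at h ⊢
  constructor <;> linarith [h.1, h.2]

lemma expInt_bounds_right : 2.7481395 < expInt 1.6268 ∧ expInt 1.6268 < 2.7481397 := by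
  have h := abs_le.1 (abs_expInt_sub_le (y := 1.6268) (by constructor <;> norm_num))
  norm_num [Finset.sum_range_succ, Nat.factorial] at h ⊢
  constructor <;> linarith [h.1, h.2]

lemma exp_bounds_left :
    3.7549555 < exp ((1.6267 : ℝ) ^ 2 / 2) ∧ exp ((1.6267 : ℝ) ^ 2 / 2) < 3.7549557 := by
  have h := abs_le.1 (abs_exp_sq_half_sub_le (t := 1.6267) (by constructor <;> norm_num))
  norm_num [Finset.sum_range_succ, Nat.factorial] at h ⊢
  constructor <;> linarith [h.1, h.2]

lemma exp_bounds_right :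
    3.7555664 < exp ((1.6268 : ℝ) ^ 2 / 2) ∧ exp ((1.6268 : ℝ) ^ 2 / 2) < 3.7555665 := by
  have h := abs_le.1 (abs_exp_sq_half_sub_le (t := 1.6268) (by constructor <;> norm_num))
  norm_num [Finset.sum_range_succ, Nat.factorial] at h ⊢
  constructor <;> linarith [h.1, h.2]

lemma slope_left_pos : 0 < slope critSq 1.6267 := by
  obtain ⟨m1, m2⟩ := critSq_bounds
  obtain ⟨f1, f2⟩ := expInt_bounds_left
  obtain ⟨e1, _⟩ := exp_bounds_left
  have hp := Real.pi_lt_d20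
  rw [slope, one_div_one_sub_critSq]
  generalize expInt 1.6267 = F at *
  generalize exp ((1.6267 : ℝ) ^ 2 / 2) = E at *
  generalize critSq = m at *
  have hB : 0.8840374 < ((1.6267 : ℝ) ^ 2 - m + 1) / (1.6267 * (1.6267 ^ 2 - m)) := by
    rw [lt_div_iff₀ (by norm_num at *; linarith)]
    norm_num at *; linarith
  have h1 : 0.8840374 * 2.747764 * 3.7549555 <
      ((1.6267 : ℝ) ^ 2 - m + 1) / (1.6267 * (1.6267 ^ 2 - m)) * F * E := by gcongr
  have h2 : F ^ 2 < 2.7477642 ^ 2 := pow_lt_pow_left₀ f2 (by norm_num at *; linarith) two_ne_zero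
  norm_num at *; linarith

/-- The value is only about -3e-5, hence the seven-digit enclosures. -/
lemma slope_right_neg : slope critSq 1.6268 < 0 := by
  obtain ⟨m1, m2⟩ := critSq_bounds
  obtain ⟨f1, f2⟩ := expInt_bounds_right
  obtain ⟨_, e2⟩ := exp_bounds_right
  have hp := Real.pi_gt_d20
  rw [slope, one_div_one_sub_critSq]
  have hE := exp_pos ((1.6268 : ℝ) ^ 2 / 2)
  generalize expInt 1.6268 = F at *
  generalize exp ((1.6268 : ℝ) ^ 2 / 2) = E at *
  generalize critSq = m at *
  have hF : 0 < F := by norm_num at *; linarith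
  have hB : ((1.6268 : ℝ) ^ 2 - m + 1) / (1.6268 * (1.6268 ^ 2 - m)) < 0.8839448 := by
    rw [div_lt_iff₀ (by norm_num at *; linarith)]
    norm_num at *; linarith
  have hB0 : 0 ≤ ((1.6268 : ℝ) ^ 2 - m + 1) / (1.6268 * (1.6268 ^ 2 - m)) :=
    div_nonneg (by norm_num at *; linarith) (by norm_num at *; linarith)
  have h1 : ((1.6268 : ℝ) ^ 2 - m + 1) / (1.6268 * (1.6268 ^ 2 - m)) * F * E <
      0.8839448 * 2.7481397 * 3.7555665 := by gcongr
  have h2 : 2.7481395 ^ 2 < F ^ 2 := pow_lt_pow_left₀ f1 (by norm_num) two_ne_zero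
  norm_num at *; linarith

lemma exists_slope_eq_zero : ∃ y : ℝ, 1.6267 < y ∧ y < 1.6268 ∧ slope critSq y = 0 := by
  have hc : ContinuousOn (slope critSq) (Icc 1.6267 1.6268) := by
    unfold slope
    have hF := continuous_expInt.continuousOn (s := Icc 1.6267 1.6268)
    refine ContinuousOn.sub (ContinuousOn.mul (ContinuousOn.mul (ContinuousOn.div
      (by fun_prop) (by fun_prop) ?_) hF) (by fun_prop)) (continuousOn_const.add (hF.pow 2))
    intro x hx
    obtain ⟨_, m2⟩ := critSq_bounds
    have h1 : (1.6267 : ℝ) ≤ x := hx.1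
    have h2 : (1.6267 : ℝ) ^ 2 ≤ x ^ 2 := pow_le_pow_left₀ (by norm_num) h1 2
    refine (mul_pos (by norm_num at *; linarith) ?_).ne'
    norm_num at *; linarith
  obtain ⟨y, hy, h0⟩ := intermediate_value_Ioo' (by norm_num) hc ⟨slope_right_neg, slope_left_pos⟩
  exact ⟨y, hy.1, hy.2, h0⟩

/-- The two constants lie just inside the interval from 1/0.687² to 1/0.686². -/
lemma sqMod_bounds {y : ℝ} (h1 : 1.6267 < y) (h2 : y < 1.6268) :
    2.1188 < sqMod critSq y ∧ sqMod critSq y < 2.1249 := by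
  obtain ⟨m1, m2⟩ := critSq_bounds
  have f1 := expInt_bounds_left.1.trans (expInt_strictMono h1)
  have f2 := (expInt_strictMono h2).trans expInt_bounds_right.2
  have hy : 0 < y := by norm_num at *; linarith
  have s1 : (1.6267 : ℝ) ^ 2 < y ^ 2 := pow_lt_pow_left₀ h1 (by norm_num) two_ne_zero
  have s2 : y ^ 2 < (1.6268 : ℝ) ^ 2 := pow_lt_pow_left₀ h2 hy.le two_ne_zero
  have e1 : 3.7549555 < exp (y ^ 2 / 2) :=
    exp_bounds_left.1.trans (exp_lt_exp.2 (by linarith))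
  have e2 : exp (y ^ 2 / 2) < 3.7555665 :=
    (exp_lt_exp.2 (by linarith)).trans exp_bounds_right.2
  have hp := Real.pi_gt_d6
  have hp' := Real.pi_lt_d6
  have he : exp (-y ^ 2) = 1 / exp (y ^ 2 / 2) ^ 2 := by
    rw [← exp_nat_mul, one_div, ← exp_neg]; congr 1; push_cast; ring
  have hE := exp_pos (y ^ 2 / 2)
  have hF2 : 2.747764 ^ 2 < expInt y ^ 2 := pow_lt_pow_left₀ f1 (by norm_num) two_ne_zero
  have hF2' : expInt y ^ 2 < 2.7481397 ^ 2 :=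
    pow_lt_pow_left₀ f2 (by norm_num at *; linarith) two_ne_zero
  have hE2 : 3.7549555 ^ 2 < exp (y ^ 2 / 2) ^ 2 := pow_lt_pow_left₀ e1 (by norm_num) two_ne_zero
  have hE2' : exp (y ^ 2 / 2) ^ 2 < 3.7555665 ^ 2 := pow_lt_pow_left₀ e2 hE.le two_ne_zero
  have e : sqMod critSq y
      = (y ^ 2 - critSq + 1) * (π / 2 + expInt y ^ 2) / exp (y ^ 2 / 2) ^ 2 := by
    rw [sqMod, one_div_one_sub_critSq, he]; ring
  have hE2pos : 0 < exp (y ^ 2 / 2) ^ 2 := by positivity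
  rw [e, lt_div_iff₀ hE2pos, div_lt_iff₀ hE2pos]
  generalize exp (y ^ 2 / 2) ^ 2 = E2 at *
  generalize expInt y ^ 2 = F2 at *
  generalize critSq = m at *
  generalize y ^ 2 = s at *
  constructor
  · have : 3.2827 * 9.1206 < (s - m + 1) * (π / 2 + F2) :=
      mul_lt_mul'' (by norm_num at *; linarith) (by norm_num at *; linarith)
        (by norm_num) (by norm_num)
    norm_num at *; linarith
  · have : (s - m + 1) * (π / 2 + F2) < 3.2832 * 9.1235 :=
      mul_lt_mul'' (by norm_num at *; linarith) (by norm_num at *; linarith)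
        (by norm_num at *; linarith) (by norm_num at *; linarith)
    norm_num at *; linarith

end InvMills

end

noncomputable section

namespace InvMills

open Complex Set Filter Topology MeasureTheory Bornology

/-! ### The Mills ratio as a Laplace transform, and its differential equation. -/

/-- The moments `∫₀^∞ uᵏ exp (-z u - u²/2) du`; `moment 0` is the Mills ratio `Psi / phi`. -/
def moment (k : ℕ) (z : ℂ) : ℂ := ∫ u in Ioi (0 : ℝ), (u : ℂ) ^ k * cexp (-z * u - u ^ 2 / 2)

lemma norm_moment_integrand (k : ℕ) (z : ℂ) {u : ℝ} (hu : 0 ≤ u) :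
    ‖(u : ℂ) ^ k * cexp (-z * u - u ^ 2 / 2)‖ = u ^ k * Real.exp (-z.re * u - u ^ 2 / 2) := by
  rw [norm_mul, norm_pow, norm_real, Real.norm_of_nonneg hu, norm_exp]
  congr 2
  have : (-z * u - u ^ 2 / 2 : ℂ) = -z * u - ((u ^ 2 / 2 : ℝ) : ℂ) := by push_cast; rfl
  rw [this, sub_re, ofReal_re, re_mul_ofReal, neg_re]

lemma integrableOn_pow_mul_exp (k : ℕ) (B : ℝ) :
    IntegrableOn (fun u : ℝ => u ^ k * Real.exp (B * u - u ^ 2 / 2)) (Ioi 0) := by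
  have h := (integrable_rpow_mul_exp_neg_mul_sq (b := 1 / 4) (by norm_num) (s := k)
    (by have : (0 : ℝ) ≤ k := k.cast_nonneg
        linarith)).const_mul (Real.exp (B ^ 2))
  refine (h.integrableOn (s := Ioi 0)).mono' (by fun_prop) ?_
  refine (ae_restrict_iff' measurableSet_Ioi).2 (.of_forall fun u hu => ?_)
  have hu : (0 : ℝ) < u := hu
  rw [Real.norm_of_nonneg (by positivity), Real.rpow_natCast, mul_left_comm, ← Real.exp_add]
  gcongr
  nlinarith [sq_nonneg (B - u / 2)]

lemma integrableOn_moment (k : ℕ) (z : ℂ) :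
    IntegrableOn (fun u : ℝ => (u : ℂ) ^ k * cexp (-z * u - u ^ 2 / 2)) (Ioi 0) := by
  refine (integrableOn_pow_mul_exp k (-z.re)).mono' (by fun_prop) ?_
  refine (ae_restrict_iff' measurableSet_Ioi).2 (.of_forall fun u hu => ?_)
  rw [norm_moment_integrand k z (le_of_lt hu)]

lemma norm_moment_le (k : ℕ) {z : ℂ} (hz : 0 ≤ z.re) :
    ‖moment k z‖ ≤ ∫ u in Ioi (0 : ℝ), u ^ k * Real.exp (0 * u - u ^ 2 / 2) := by
  refine norm_integral_le_of_norm_le (integrableOn_pow_mul_exp k 0) ?_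
  refine (ae_restrict_iff' measurableSet_Ioi).2 (.of_forall fun u hu => ?_)
  have hu : (0 : ℝ) < u := hu
  rw [norm_moment_integrand k z hu.le]
  gcongr
  linarith

lemma hasDerivAt_integrand (z : ℂ) (u : ℝ) :
    HasDerivAt (fun u : ℝ => cexp (-z * u - u ^ 2 / 2))
      (-(z * ((u : ℂ) ^ 0 * cexp (-z * u - u ^ 2 / 2))
        + (u : ℂ) ^ 1 * cexp (-z * u - u ^ 2 / 2))) u := by
  have h : HasDerivAt (fun w : ℂ => -z * w - w ^ 2 / 2) (-z - u) (u : ℂ) := by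
    refine HasDerivAt.congr_deriv (((hasDerivAt_id' (u : ℂ)).const_mul (-z)).fun_sub
      (((hasDerivAt_id' (u : ℂ)).fun_pow 2).div_const 2)) ?_
    simp
  refine HasDerivAt.congr_deriv h.cexp.comp_ofReal ?_
  ring

lemma mul_moment_zero_add (z : ℂ) : z * moment 0 z + moment 1 z = 1 := by
  have h0 := integrableOn_moment 0 z
  have h1 := integrableOn_moment 1 z
  have hi := (h0.const_mul z).add h1
  -- The boundary term at infinity vanishes because the function and its derivative are both
  -- integrable.
  have hl := tendsto_zero_of_hasDerivAt_of_integrableOn_Ioi (a := 0)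
    (fun u _ => hasDerivAt_integrand z u) hi.neg (by simpa using h0)
  have := integral_Ioi_of_hasDerivAt_of_tendsto' (a := 0)
    (fun u _ => hasDerivAt_integrand z u) hi.neg hl
  rw [integral_neg, integral_add (h0.const_mul z) h1, integral_const_mul] at this
  simp only [ofReal_zero] at this
  have h3 : -(z * moment 0 z + moment 1 z) = 0 - cexp (-z * 0 - 0 ^ 2 / 2) := this
  simp only [mul_zero, zero_pow two_ne_zero, zero_div, sub_zero, Complex.exp_zero, zero_sub] at h3
  exact neg_injective h3

lemma mul_moment_one_add (z : ℂ) : z * moment 1 z + moment 2 z = moment 0 z := by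
  have h0 := integrableOn_moment 0 z
  have h1 := integrableOn_moment 1 z
  have h2 := integrableOn_moment 2 z
  have hi := h0.sub ((h1.const_mul z).add h2)
  have hd : ∀ u : ℝ, HasDerivAt (fun u : ℝ => (u : ℂ) ^ 1 * cexp (-z * u - u ^ 2 / 2))
      ((u : ℂ) ^ 0 * cexp (-z * u - u ^ 2 / 2) - (z * ((u : ℂ) ^ 1 * cexp (-z * u - u ^ 2 / 2))
        + (u : ℂ) ^ 2 * cexp (-z * u - u ^ 2 / 2))) u := by
    intro u
    refine HasDerivAt.congr_deriv
      (((hasDerivAt_id' (u : ℂ)).comp_ofReal.fun_pow 1).fun_mul (hasDerivAt_integrand z u)) ?_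
    push_cast
    ring
  have hl := tendsto_zero_of_hasDerivAt_of_integrableOn_Ioi (a := 0) (fun u _ => hd u) hi h1
  have := integral_Ioi_of_hasDerivAt_of_tendsto' (a := 0) (fun u _ => hd u) hi hl
  have h3 := integral_add (h1.const_mul z) h2
  have h4 := integral_sub h0 ((h1.const_mul z).add h2)
  simp only [Pi.add_apply] at h4
  rw [h4, h3, integral_const_mul] at this
  have h5 : moment 0 z - (z * moment 1 z + moment 2 z) = 0 - ((0 : ℝ) : ℂ) ^ 1 * _ := this
  rw [ofReal_zero, zero_pow one_ne_zero, zero_mul, sub_zero, sub_eq_zero] at h5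
  exact h5.symm

lemma hasDerivAt_moment_zero (z : ℂ) : HasDerivAt (moment 0) (z * moment 0 z - 1) z := by
  have key := (hasDerivAt_integral_of_dominated_loc_of_deriv_le
    (μ := volume.restrict (Ioi (0 : ℝ))) (s := Metric.ball z 1) (x₀ := z)
    (F := fun (w : ℂ) (u : ℝ) => (u : ℂ) ^ 0 * cexp (-w * u - u ^ 2 / 2))
    (F' := fun (w : ℂ) (u : ℝ) => -((u : ℂ) ^ 1 * cexp (-w * u - u ^ 2 / 2)))
    (bound := fun u : ℝ => u ^ 1 * Real.exp ((‖z‖ + 1) * u - u ^ 2 / 2))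
    (Metric.ball_mem_nhds z one_pos)
    (.of_forall fun w => (integrableOn_moment 0 w).aestronglyMeasurable)
    (integrableOn_moment 0 z) (integrableOn_moment 1 z).neg.aestronglyMeasurable ?_
    (integrableOn_pow_mul_exp 1 _) ?_).2
  · refine HasDerivAt.congr_deriv key ?_
    rw [integral_neg]
    change -moment 1 z = _
    linear_combination -mul_moment_zero_add z
  · refine (ae_restrict_iff' measurableSet_Ioi).2 (.of_forall fun u hu w hw => ?_)
    have hu : (0 : ℝ) < u := hu
    rw [norm_neg, norm_moment_integrand 1 w hu.le]
    gcongr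
    have h1 : ‖w‖ ≤ ‖z‖ + 1 := by
      have := norm_le_insert' w z
      rw [Metric.mem_ball, dist_eq_norm] at hw
      linarith
    have := (abs_le.1 (abs_re_le_norm w)).1
    linarith
  · refine .of_forall fun u w _ => ?_
    have h : HasDerivAt (fun w : ℂ => -w * u - u ^ 2 / 2) (-u : ℂ) w := by
      refine HasDerivAt.congr_deriv (((hasDerivAt_id' w).fun_neg.mul_const (u : ℂ)).sub_const _) ?_
      simp
    refine HasDerivAt.congr_deriv (h.cexp.const_mul ((u : ℂ) ^ 0)) ?_
    ring

lemma differentiable_moment_zero : Differentiable ℂ (moment 0) :=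
  fun z => (hasDerivAt_moment_zero z).differentiableAt

lemma phi_ne_zero (z : ℂ) : phi z ≠ 0 := by
  have : (1 / Real.sqrt (2 * Real.pi)) ≠ 0 := by positivity
  exact mul_ne_zero (by exact_mod_cast this) (exp_ne_zero _)

lemma hasDerivAt_phi (z : ℂ) : HasDerivAt phi (-z * phi z) z := by
  unfold phi
  have h : HasDerivAt (fun w : ℂ => -w ^ 2 / 2) (-z) z := by
    refine HasDerivAt.congr_deriv ((((hasDerivAt_id' z).fun_pow 2).fun_neg).div_const 2) ?_
    simp; ring
  refine HasDerivAt.congr_deriv (h.cexp.const_mul _) ?_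
  ring

lemma hasDerivAt_phi_mul_moment (z : ℂ) :
    HasDerivAt (fun w => phi w * moment 0 w) (-phi z) z := by
  refine HasDerivAt.congr_deriv ((hasDerivAt_phi z).fun_mul (hasDerivAt_moment_zero z)) ?_
  ring

lemma phi_add (x : ℂ) (u : ℝ) :
    phi (x + u) = phi x * ((u : ℂ) ^ 0 * cexp (-x * u - u ^ 2 / 2)) := by
  unfold phi
  rw [pow_zero, one_mul, mul_assoc, ← Complex.exp_add]
  congr 2
  ring

lemma integral_phi_add (x : ℂ) : ∫ u in Ioi (0 : ℝ), phi (x + u) = phi x * moment 0 x := by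
  simp_rw [phi_add, moment, integral_const_mul]

/-- φM is an antiderivative of -φ, which evaluates the segment; the half-line contributes φ(0)M(0),
and this cancels. -/
lemma Psi_eq (z : ℂ) : Psi z = phi z * moment 0 z := by
  have h0 := integral_phi_add 0
  simp only [zero_add] at h0
  have hc : Continuous phi := by unfold phi; fun_prop
  have hd : ∀ t : ℝ, HasDerivAt (fun t : ℝ => -(phi (t * z) * moment 0 (t * z)))
      (phi (t * z) * z) t := by
    intro t
    have h1 : HasDerivAt (fun w : ℂ => w * z) z (t : ℂ) := by
      simpa using (hasDerivAt_id' (t : ℂ)).mul_const z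
    have h2 := (HasDerivAt.comp (t : ℂ) (hasDerivAt_phi_mul_moment ((t : ℂ) * z)) h1)
    refine HasDerivAt.congr_deriv h2.comp_ofReal.fun_neg ?_
    ring
  have := intervalIntegral.integral_eq_sub_of_hasDerivAt (a := 0) (b := 1) (fun t _ => hd t)
    (Continuous.intervalIntegrable (by fun_prop) _ _)
  rw [Psi, h0, this]
  simp

lemma differentiable_Psi : Differentiable ℂ Psi := by
  have : Psi = fun w => phi w * moment 0 w := funext Psi_eq
  rw [this]
  exact fun z => (hasDerivAt_phi_mul_moment z).differentiableAt

lemma phi_ofReal (u : ℝ) : phi u = (ProbabilityTheory.gaussianPDFReal 0 1 u : ℂ) := by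
  simp [phi, ProbabilityTheory.gaussianPDFReal]

lemma Psi_ofReal (x : ℝ) :
    Psi x = ((∫ u in Ioi x, ProbabilityTheory.gaussianPDFReal 0 1 u : ℝ) : ℂ) := by
  rw [Psi_eq, ← integral_phi_add, ← integral_complex_ofReal]
  simp_rw [← phi_ofReal]
  have := (measurePreserving_add_right volume x).setIntegral_preimage_emb
    (measurableEmbedding_addRight x) (fun u : ℝ => phi u) (Ioi x)
  rw [← this]
  simp [add_comm]

/-! ### The reciprocal of S and its values on the imaginary axis. -/

/-- The reciprocal of `S`. -/
def recipS (z : ℂ) : ℂ := (z + (Real.sqrt (2 / Real.pi) : ℂ)) * moment 0 z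

lemma S_eq (z : ℂ) : S z = (recipS z)⁻¹ := by
  have := phi_ne_zero z
  rw [S, R, Psi_eq, recipS, mul_inv, div_mul_cancel_left₀ this, div_eq_mul_inv, mul_comm]

lemma differentiable_recipS : Differentiable ℂ recipS := by
  have := differentiable_moment_zero
  unfold recipS
  fun_prop

lemma moment_zero_zero : moment 0 0 = (Real.sqrt (Real.pi / 2) : ℂ) := by
  have h := integral_gaussian_Ioi (1 / 2)
  have e : moment 0 0 = ((∫ x in Ioi (0 : ℝ), Real.exp (-(1 / 2) * x ^ 2) : ℝ) : ℂ) := by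
    rw [moment, ← integral_complex_ofReal]
    congr 1
    ext u
    push_cast
    rw [pow_zero, one_mul]
    congr 1
    ring
  rw [e, h]
  have : Real.pi / (1 / 2) = 2 ^ 2 * (Real.pi / 2) := by ring
  rw [this, Real.sqrt_mul (by norm_num), Real.sqrt_sq (by norm_num)]
  push_cast
  ring

lemma recipS_zero : recipS 0 = 1 := by
  rw [recipS, moment_zero_zero, zero_add, ← ofReal_mul, ← Real.sqrt_mul (by positivity)]
  have : 2 / Real.pi * (Real.pi / 2) = 1 := by field_simp
  simp [this]

/-- On the imaginary axis the Mills ratio is elementary up to `expInt`. -/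
lemma exp_mul_moment_I (y : ℝ) : (Real.exp (y ^ 2 / 2) : ℂ) * moment 0 (I * y) =
    (Real.sqrt (Real.pi / 2) : ℂ) - I * (expInt y : ℂ) := by
  -- By M' = zM - 1, the derivative of e^{t²/2} M(it) is -i e^{t²/2}.
  have hd : ∀ t : ℝ, HasDerivAt (fun t : ℝ => (Real.exp (t ^ 2 / 2) : ℂ) * moment 0 (I * t)
      + I * (expInt t : ℂ)) 0 t := by
    intro t
    have h1 : HasDerivAt (fun w : ℂ => I * w) I (t : ℂ) := by
      simpa using (hasDerivAt_id' (t : ℂ)).const_mul I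
    have h2 := ((hasDerivAt_moment_zero (I * t)).comp (t : ℂ) h1).comp_ofReal
    refine HasDerivAt.congr_deriv (((hasDerivAt_exp_sq_half t).ofReal_comp.fun_mul h2).fun_add
      ((hasDerivAt_expInt t).ofReal_comp.const_mul I)) ?_
    simp only [Function.comp]
    push_cast
    linear_combination (cexp (t ^ 2 / 2) * t * moment 0 (I * t)) * I_sq
  have := is_const_of_deriv_eq_zero (fun t => (hd t).differentiableAt) (fun t => (hd t).deriv) y 0
  simp [expInt_zero, moment_zero_zero] at this ⊢
  linear_combination this

lemma moment_I_re_pos (y : ℝ) : 0 < (moment 0 (I * y)).re := by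
  have h := congrArg re (exp_mul_moment_I y)
  rw [re_ofReal_mul, sub_re, ofReal_re, I_mul_re, ofReal_im] at h
  have h2 : 0 < Real.sqrt (Real.pi / 2) := by positivity
  have h3 := Real.exp_pos (y ^ 2 / 2)
  refine (mul_pos_iff_of_pos_left h3).1 ?_
  linarith

lemma norm_recipS_I_sq (y : ℝ) : ‖recipS (I * y)‖ ^ 2 = sqMod critSq y := by
  have h := congrArg normSq (exp_mul_moment_I y)
  have h1 : normSq ((Real.sqrt (Real.pi / 2) : ℂ) - I * (expInt y : ℂ))
      = Real.pi / 2 + expInt y ^ 2 := by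
    have hs : Real.sqrt (Real.pi / 2) ^ 2 = Real.pi / 2 := Real.sq_sqrt (by positivity)
    rw [normSq_apply]
    simp only [sub_re, sub_im, I_mul_re, I_mul_im, ofReal_re, ofReal_im]
    linear_combination hs
  have h2 : normSq (I * y + (Real.sqrt (2 / Real.pi) : ℂ)) = y ^ 2 + 2 / Real.pi := by
    have hs : Real.sqrt (2 / Real.pi) ^ 2 = 2 / Real.pi := Real.sq_sqrt (by positivity)
    rw [normSq_apply]
    simp only [add_re, add_im, I_mul_re, I_mul_im, ofReal_re, ofReal_im]
    linear_combination hs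
  rw [normSq_mul, normSq_ofReal, h1] at h
  rw [← normSq_eq_norm_sq, recipS, normSq_mul, h2, sqMod, one_div_one_sub_critSq, ← h]
  have he : Real.exp (-y ^ 2) * (Real.exp (y ^ 2 / 2) * Real.exp (y ^ 2 / 2)) = 1 := by
    rw [← Real.exp_add, ← Real.exp_add, Real.exp_eq_one_iff]; ring
  unfold critSq
  linear_combination (-(y ^ 2 + 2 / Real.pi) * normSq (moment 0 (I * y))) * he

/-! ### Maximum principle and behaviour at infinity in the half-plane. -/

lemma closure_pos_re : closure {z : ℂ | 0 < z.re} = Hplus := Complex.closure_setOfPred_lt_re 0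

lemma tendsto_ofReal_cobounded_Hplus :
    Tendsto (fun x : ℝ => (x : ℂ)) atTop (cobounded ℂ ⊓ 𝓟 Hplus) := by
  refine tendsto_inf.2 ⟨?_, tendsto_principal.2 ?_⟩
  · rw [← tendsto_norm_atTop_iff_cobounded]
    simpa using tendsto_abs_atTop_atTop
  · filter_upwards [eventually_ge_atTop 0] with x hx
    simpa [Hplus] using hx

lemma tendsto_I_mul_cobounded_Hplus :
    Tendsto (fun x : ℝ => I * (x : ℂ)) atTop (cobounded ℂ ⊓ 𝓟 Hplus) := by
  refine tendsto_inf.2 ⟨?_, tendsto_principal.2 ?_⟩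
  · rw [← tendsto_norm_atTop_iff_cobounded]
    simpa using tendsto_abs_atTop_atTop
  · exact .of_forall fun x => by simp [Hplus]

/-- Strict Phragmen-Lindelöf principle in the right half-plane for functions with a limit at
infinity. -/
lemma norm_lt_of_pos_re {f : ℂ → ℂ} {l : ℂ} {C y₁ : ℝ} (hd : DiffContOnCl ℂ f {z | 0 < z.re})
    (hl : Tendsto f (cobounded ℂ ⊓ 𝓟 Hplus) (𝓝 l)) (him : ∀ y : ℝ, ‖f (I * y)‖ ≤ C)
    (hlt : ‖f (I * y₁)‖ < C) {z : ℂ} (hz : 0 < z.re) : ‖f z‖ < C := by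
  have hle : ∀ w : ℂ, 0 < w.re → ‖f w‖ ≤ C := fun w hw => by
    -- Growth coefficient 0: the limit at infinity already makes f bounded there.
    refine PhragmenLindelof.right_half_plane_of_bounded_on_real hd ⟨1, one_lt_two, 0, ?_⟩
      ((hl.comp tendsto_ofReal_cobounded_Hplus).norm.isBoundedUnder_le)
      (fun x => by rw [mul_comm]; exact him x) hw.le
    have hsub : {w : ℂ | 0 < w.re} ⊆ Hplus := fun w (hw : 0 < w.re) =>
      show 0 ≤ w.re from hw.le
    have h := hl.mono_left (inf_le_inf_left (cobounded ℂ) (principal_mono.2 hsub))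
    simpa using h.isBigO_one ℝ
  -- Equality at an interior point would make |f| constant up to the boundary, contrary to its value
  -- at iy₁.
  refine lt_of_le_of_ne (hle z hz) fun he => ?_
  have hm : IsMaxOn (norm ∘ f) {z | 0 < z.re} z := fun w hw => by
    simpa [he] using hle w hw
  have := norm_eqOn_closure_of_isPreconnected_of_isMaxOn
    (convex_halfSpace_re_gt 0).isPreconnected (isOpen_lt continuous_const continuous_re) hd hz hm
  have h1 := this (x := I * y₁) (by rw [closure_pos_re]; simp [Hplus])
  simp only [Function.comp, Function.const] at h1
  rw [h1, he] at hlt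
  exact lt_irrefl _ hlt

/-- A bound for `moment k` on the right half-plane. -/
def momentBound (k : ℕ) : ℝ :=
  ∫ u in Ioi (0 : ℝ), u ^ k * Real.exp (0 * u - u ^ 2 / 2)

lemma tendsto_zero_of_norm_mul_le {f : ℂ → ℂ} {C : ℝ} (h : ∀ z ∈ Hplus, ‖z * f z‖ ≤ C) :
    Tendsto f (cobounded ℂ ⊓ 𝓟 Hplus) (𝓝 0) := by
  have h1 : Tendsto (fun z : ℂ => C * ‖z‖⁻¹) (cobounded ℂ ⊓ 𝓟 Hplus) (𝓝 0) := by
    have := (tendsto_inv_atTop_zero.comp (tendsto_norm_cobounded_atTop (E := ℂ))).const_mul C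
    rw [mul_zero] at this
    exact this.mono_left inf_le_left
  refine squeeze_zero_norm' ?_ h1
  have h2 : ∀ᶠ z in cobounded ℂ ⊓ 𝓟 Hplus, z ∈ Hplus :=
    mem_inf_of_right (mem_principal_self _)
  have h3 : ∀ᶠ z in cobounded ℂ ⊓ 𝓟 Hplus, 0 < ‖z‖ :=
    ((tendsto_norm_cobounded_atTop (E := ℂ)).eventually_gt_atTop 0).filter_mono inf_le_left
  filter_upwards [h2, h3] with z hz hz0
  rw [← div_eq_mul_inv, le_div_iff₀ hz0, mul_comm, ← norm_mul]
  exact h z hz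

lemma tendsto_moment_zero : Tendsto (moment 0) (cobounded ℂ ⊓ 𝓟 Hplus) (𝓝 0) := by
  refine tendsto_zero_of_norm_mul_le (C := 1 + momentBound 1) fun z hz => ?_
  have h : z * moment 0 z = 1 - moment 1 z := by linear_combination mul_moment_zero_add z
  rw [h]
  refine (norm_sub_le _ _).trans ?_
  rw [norm_one]
  exact add_le_add_right (norm_moment_le 1 hz) 1

lemma tendsto_moment_one : Tendsto (moment 1) (cobounded ℂ ⊓ 𝓟 Hplus) (𝓝 0) := by
  refine tendsto_zero_of_norm_mul_le (C := momentBound 0 + momentBound 2) fun z hz => ?_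
  have h : z * moment 1 z = moment 0 z - moment 2 z := by linear_combination mul_moment_one_add z
  rw [h]
  exact (norm_sub_le _ _).trans (add_le_add (norm_moment_le 0 hz) (norm_moment_le 2 hz))

/-- By the first moment identity, 1/S = 1 - `moment 1` + c M. -/
lemma tendsto_recipS : Tendsto recipS (cobounded ℂ ⊓ 𝓟 Hplus) (𝓝 1) := by
  have h := (tendsto_moment_zero.const_mul (Real.sqrt (2 / Real.pi) : ℂ)).add
    (tendsto_moment_one.const_sub 1)
  simp only [mul_zero, sub_zero, zero_add] at h
  refine h.congr fun z => ?_
  rw [recipS]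
  linear_combination -mul_moment_zero_add z

lemma tendsto_S : Tendsto S (cobounded ℂ ⊓ 𝓟 Hplus) (𝓝 1) := by
  have := tendsto_recipS.inv₀ one_ne_zero
  rw [inv_one] at this
  exact this.congr fun z => (S_eq z).symm

/-! ### Absence of zeros and holomorphy of S. -/

lemma eq_I_mul_of_re_eq_zero {z : ℂ} (hz : z.re = 0) : z = I * (z.im : ℂ) := by
  apply Complex.ext <;> simp [hz]

/-- A minimum principle for Re M, obtained from |e^{-M}| = e^{-Re M}, which is below 1 on the
imaginary axis. -/
lemma moment_zero_re_pos {z : ℂ} (hz : z ∈ Hplus) : 0 < (moment 0 z).re := by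
  rcases (show 0 ≤ z.re from hz).eq_or_lt with h | h
  · rw [eq_I_mul_of_re_eq_zero h.symm]
    exact moment_I_re_pos _
  · have hd : Differentiable ℂ fun w => cexp (-moment 0 w) := differentiable_moment_zero.neg.cexp
    have hl := tendsto_moment_zero.neg.cexp
    have him : ∀ y : ℝ, ‖cexp (-moment 0 (I * y))‖ < 1 := fun y => by
      rw [norm_exp, Real.exp_lt_one_iff, neg_re]
      linarith [moment_I_re_pos y]
    have := norm_lt_of_pos_re (C := 1) (y₁ := 0) hd.diffContOnCl hl (fun y => (him y).le) (him 0) h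
    rw [norm_exp, Real.exp_lt_one_iff, neg_re] at this
    linarith

lemma moment_zero_ne_zero {z : ℂ} (hz : z ∈ Hplus) : moment 0 z ≠ 0 := fun h => by
  have := moment_zero_re_pos hz
  rw [h, zero_re] at this
  exact lt_irrefl _ this

lemma Psi_ne_zero {z : ℂ} (hz : z ∈ Hplus) : Psi z ≠ 0 := by
  rw [Psi_eq]
  exact mul_ne_zero (phi_ne_zero z) (moment_zero_ne_zero hz)

lemma add_sqrt_ne_zero {z : ℂ} (hz : z ∈ Hplus) : z + (Real.sqrt (2 / Real.pi) : ℂ) ≠ 0 := by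
  intro h
  have h1 := congrArg re h
  have h2 : 0 < Real.sqrt (2 / Real.pi) := by positivity
  have h3 : 0 ≤ z.re := hz
  rw [add_re, ofReal_re, zero_re] at h1
  linarith

lemma recipS_ne_zero {z : ℂ} (hz : z ∈ Hplus) : recipS z ≠ 0 :=
  mul_ne_zero (add_sqrt_ne_zero hz) (moment_zero_ne_zero hz)

lemma differentiableAt_S {z : ℂ} (hz : z ∈ Hplus) : DifferentiableAt ℂ S z := by
  have : S = fun w => (recipS w)⁻¹ := funext S_eq
  rw [this]
  exact (differentiable_recipS z).inv (recipS_ne_zero hz)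

lemma diffContOnCl_S : DiffContOnCl ℂ S {z | 0 < z.re} := by
  refine ⟨fun z (hz : 0 < z.re) =>
    (differentiableAt_S (show 0 ≤ z.re from hz.le)).differentiableWithinAt, ?_⟩
  rw [closure_pos_re]
  exact fun z hz => (differentiableAt_S hz).continuousAt.continuousWithinAt

/-! ### Strict bounds for |S| and their exactness. -/

lemma S_zero : S 0 = 1 := by rw [S_eq, recipS_zero, inv_one]

lemma norm_S_neg_I (y : ℝ) : ‖S (-(I * y))‖ = ‖S (I * y)‖ := by
  have h := norm_recipS_I_sq (-y)
  rw [sqMod_neg, ← norm_recipS_I_sq y, sq_eq_sq₀ (norm_nonneg _) (norm_nonneg _)] at h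
  rw [S_eq, S_eq, norm_inv, norm_inv, ← h, ofReal_neg, mul_neg]

lemma tendsto_sqMod : Tendsto (sqMod critSq) atTop (𝓝 1) := by
  have := (tendsto_recipS.comp tendsto_I_mul_cobounded_Hplus).norm.pow 2
  rw [norm_one, one_pow] at this
  exact this.congr norm_recipS_I_sq

lemma sqMod_lt_peak {y₀ : ℝ} (hy₀ : 0 < y₀) (hmono : StrictMonoOn (sqMod critSq) (Icc 0 y₀))
    (hanti : StrictAntiOn (sqMod critSq) (Ici y₀)) {y : ℝ} (h1 : y ≠ y₀) (h2 : y ≠ -y₀) :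
    sqMod critSq y < sqMod critSq y₀ := by
  have key : ∀ x : ℝ, 0 ≤ x → x ≠ y₀ → sqMod critSq x < sqMod critSq y₀ := fun x hx hne => by
    rcases lt_or_gt_of_ne hne with h | h
    · exact hmono ⟨hx, h.le⟩ ⟨hy₀.le, le_rfl⟩ h
    · exact hanti self_mem_Ici h.le h
  rcases le_total 0 y with h | h
  · exact key y h h1
  · rw [← sqMod_neg]
    exact key (-y) (by linarith) fun h => h2 (by linarith)

lemma one_lt_sqMod {y₀ : ℝ} (hy₀ : 0 < y₀) (hmono : StrictMonoOn (sqMod critSq) (Icc 0 y₀))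
    (hanti : StrictAntiOn (sqMod critSq) (Ici y₀)) {y : ℝ} (h0 : y ≠ 0) :
    1 < sqMod critSq y := by
  have key : ∀ x : ℝ, 0 < x → 1 < sqMod critSq x := fun x hx => by
    rcases le_total x y₀ with h | h
    · have := hmono ⟨le_rfl, hy₀.le⟩ ⟨hx.le, h⟩ hx
      rwa [sqMod_zero (by linarith [critSq_bounds.2])] at this
    · have h1 : sqMod critSq (x + 1) < sqMod critSq x :=
        hanti h (by simp only [mem_Ici]; linarith) (by linarith)
      refine lt_of_le_of_lt ?_ h1
      refine le_of_tendsto tendsto_sqMod ?_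
      filter_upwards [eventually_ge_atTop (x + 1)] with t ht
      exact hanti.antitoneOn (by simp only [mem_Ici]; linarith)
        (by simp only [mem_Ici]; linarith) ht
  rcases lt_or_gt_of_ne h0 with h | h
  · rw [← sqMod_neg]; exact key _ (by linarith)
  · exact key y h

/-- The point a need not belong to s: it is approached horizontally through the open half-plane. -/
lemma isGLB_norm_S {a : ℂ} (ha : a.re = 0) {s : Set ℂ} (hs : ∀ z : ℂ, 0 < z.re → z ∈ s)
    (hlt : ∀ z ∈ s, ‖S a‖ < ‖S z‖) : IsGLB ((fun z : ℂ => ‖S z‖) '' s) ‖S a‖ := by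
  refine ⟨?_, fun b hb => ?_⟩
  · rintro _ ⟨z, hz, rfl⟩
    exact (hlt z hz).le
  · have hc : ContinuousAt (fun z => ‖S z‖) a :=
      (differentiableAt_S (show 0 ≤ a.re from ha.ge)).continuousAt.norm
    have ht : Tendsto (fun t : ℝ => a + t) (𝓝[>] 0) (𝓝 a) := by
      have : Continuous fun t : ℝ => a + t := by fun_prop
      simpa using this.continuousAt.tendsto.mono_left (nhdsWithin_le_nhds (a := 0) (s := Ioi 0))
    refine ge_of_tendsto (hc.tendsto.comp ht) ?_
    filter_upwards [self_mem_nhdsWithin] with t ht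
    exact hb ⟨a + t, hs _ (by simpa [ha] using ht), rfl⟩

lemma isLUB_norm_S {s : Set ℂ} (hs : ∀ z : ℂ, 0 < z.re → z ∈ s)
    (hlt : ∀ z ∈ s, ‖S z‖ < 1) : IsLUB ((fun z : ℂ => ‖S z‖) '' s) 1 := by
  refine ⟨?_, fun b hb => ?_⟩
  · rintro _ ⟨z, hz, rfl⟩
    exact (hlt z hz).le
  · have ht := (tendsto_S.comp tendsto_ofReal_cobounded_Hplus).norm
    rw [norm_one] at ht
    refine le_of_tendsto ht ?_
    filter_upwards [eventually_gt_atTop 0] with t ht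
    exact hb ⟨t, hs _ (by simpa using ht), rfl⟩

/-- The strict two-sided bound on the closed right half-plane, given the unimodality of the squared
modulus of `1 / S` on the imaginary axis. -/
lemma norm_S_mem_Ioo {y₀ : ℝ} (hy₀ : 0 < y₀) (hmono : StrictMonoOn (sqMod critSq) (Icc 0 y₀))
    (hanti : StrictAntiOn (sqMod critSq) (Ici y₀)) {z : ℂ} (hz : z ∈ Hplus) (h0 : z ≠ 0)
    (h1 : z ≠ I * y₀) (h2 : z ≠ -(I * y₀)) : ‖S z‖ < 1 ∧ ‖S (I * y₀)‖ < ‖S z‖ := by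
  have hpos : ∀ w ∈ Hplus, 0 < ‖recipS w‖ := fun w hw => norm_pos_iff.2 (recipS_ne_zero hw)
  have hI : ∀ y : ℝ, I * (y : ℂ) ∈ Hplus := fun y => by simp [Hplus]
  suffices h : 1 < ‖recipS z‖ ∧ ‖recipS z‖ < ‖recipS (I * y₀)‖ by
    simp only [S_eq, norm_inv]
    exact ⟨inv_lt_one_of_one_lt₀ h.1, (inv_lt_inv₀ (hpos _ (hI y₀)) (hpos z hz)).2 h.2⟩
  have hax1 : ∀ y : ℝ, y ≠ 0 → 1 < ‖recipS (I * y)‖ := fun y hy => by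
    have := one_lt_sqMod hy₀ hmono hanti hy
    rw [← norm_recipS_I_sq] at this
    exact (one_lt_sq_iff₀ (norm_nonneg _)).1 this
  have hax2 : ∀ y : ℝ, y ≠ y₀ → y ≠ -y₀ → ‖recipS (I * y)‖ < ‖recipS (I * y₀)‖ := fun y h h' => by
    have := sqMod_lt_peak hy₀ hmono hanti h h'
    rw [← norm_recipS_I_sq, ← norm_recipS_I_sq] at this
    exact (sq_lt_sq₀ (norm_nonneg _) (norm_nonneg _)).1 this
  rcases (show 0 ≤ z.re from hz).eq_or_lt with h | h
  · have e := eq_I_mul_of_re_eq_zero h.symm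
    have n0 : z.im ≠ 0 := fun h => h0 (by rw [e, h]; simp)
    have n1 : z.im ≠ y₀ := fun h => h1 (by rw [e, h])
    have n2 : z.im ≠ -y₀ := fun h => h2 (by rw [e, h]; simp)
    rw [e]
    exact ⟨hax1 _ n0, hax2 _ n1 n2⟩
  · constructor
    · have hS : ‖S z‖ < 1 := by
        refine norm_lt_of_pos_re (y₁ := y₀) diffContOnCl_S tendsto_S (fun y => ?_) ?_ h
        · rcases eq_or_ne y 0 with rfl | hy
          · simp [S_zero]
          · rw [S_eq, norm_inv]
            exact inv_le_one_of_one_le₀ (hax1 y hy).le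
        · rw [S_eq, norm_inv]
          exact inv_lt_one_of_one_lt₀ (hax1 y₀ hy₀.ne')
      rw [S_eq, norm_inv] at hS
      exact (inv_lt_one₀ (hpos z hz)).1 hS
    -- The origin serves as the boundary point of strict inequality, where 1/S lies below its peak
    -- modulus.
    · refine norm_lt_of_pos_re (y₁ := 0) differentiable_recipS.diffContOnCl tendsto_recipS
        (fun y => ?_) (hax2 0 hy₀.ne (by linarith)) h
      by_cases h : y = y₀
      · rw [h]
      · by_cases h' : y = -y₀
        · have := norm_S_neg_I y₀
          rw [S_eq, S_eq, norm_inv, norm_inv, inv_inj] at this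
          rw [h', ofReal_neg, mul_neg, this]
        · exact (hax2 y h h').le

lemma norm_S_peak_bounds {y : ℝ} (h1 : 1.6267 < y) (h2 : y < 1.6268) :
    0.686 ≤ ‖S (I * y)‖ ∧ ‖S (I * y)‖ < 0.687 := by
  obtain ⟨b1, b2⟩ := sqMod_bounds h1 h2
  have hs : ‖S (I * y)‖ ^ 2 * sqMod critSq y = 1 := by
    rw [← norm_recipS_I_sq, S_eq, norm_inv, ← mul_pow, inv_mul_cancel₀, one_pow]
    exact norm_ne_zero_iff.2 (recipS_ne_zero (by simp [Hplus]))
  have hn := norm_nonneg (S (I * y))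
  generalize ‖S (I * y)‖ = r at *
  constructor
  · by_contra! h
    have : r ^ 2 < 0.686 ^ 2 := pow_lt_pow_left₀ h hn two_ne_zero
    have : r ^ 2 * sqMod critSq y < 0.686 ^ 2 * 2.1249 :=
      mul_lt_mul'' this b2 (by positivity) (by norm_num at *; linarith)
    norm_num at *; linarith
  · by_contra! h
    have : (0.687 : ℝ) ^ 2 ≤ r ^ 2 := pow_le_pow_left₀ (by norm_num) h 2
    have : (0.687 : ℝ) ^ 2 * 2.1188 ≤ r ^ 2 * sqMod critSq y :=
      mul_le_mul this b1.le (by norm_num) (by positivity)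
    norm_num at *; linarith

end InvMills

end

theorem theorem1 :
    -- `Psi` is the entire extension of the standard normal tail function
    (Differentiable ℂ InvMills.Psi ∧
      ∀ x : ℝ, InvMills.Psi (x : ℂ) =
        ((∫ u in Set.Ioi x, ProbabilityTheory.gaussianPDFReal 0 1 u : ℝ) : ℂ)) ∧
    -- no zeros on the closed right half-plane; `S` is well defined there, holomorphic inside
    (∀ z ∈ InvMills.Hplus, InvMills.Psi z ≠ 0) ∧
    (∀ z ∈ InvMills.Hplus, z + (Real.sqrt (2 / Real.pi) : ℂ) ≠ 0) ∧
    DifferentiableOn ℂ InvMills.S (interior InvMills.Hplus) ∧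
    -- the unique minimizer on the positive imaginary axis, and the strict two-sided bound
    (∃ y₀ : ℝ,
      (0 < y₀ ∧
        IsMinOn (fun y : ℝ => ‖InvMills.S (Complex.I * (y : ℂ))‖) (Set.Ioi 0) y₀ ∧
        ∀ y₁ : ℝ, 0 < y₁ →
          IsMinOn (fun y : ℝ => ‖InvMills.S (Complex.I * (y : ℂ))‖) (Set.Ioi 0) y₁ →
          y₁ = y₀) ∧
      (1.6267 ≤ y₀ ∧ y₀ < 1.6268) ∧
      (0.686 ≤ ‖InvMills.S (Complex.I * (y₀ : ℂ))‖ ∧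
        ‖InvMills.S (Complex.I * (y₀ : ℂ))‖ < 0.687) ∧
      (∀ z ∈ InvMills.Hplus \ {0, Complex.I * (y₀ : ℂ), -(Complex.I * (y₀ : ℂ))},
        ‖InvMills.S z‖ < 1 ∧ ‖InvMills.S (Complex.I * (y₀ : ℂ))‖ < ‖InvMills.S z‖) ∧
      -- both bounds are the best possible constants
      IsGLB ((fun z : ℂ => ‖InvMills.S z‖) ''
          (InvMills.Hplus \ {0, Complex.I * (y₀ : ℂ), -(Complex.I * (y₀ : ℂ))}))
        ‖InvMills.S (Complex.I * (y₀ : ℂ))‖ ∧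
      IsLUB ((fun z : ℂ => ‖InvMills.S z‖) ''
          (InvMills.Hplus \ {0, Complex.I * (y₀ : ℂ), -(Complex.I * (y₀ : ℂ))})) 1) ∧
    -- exactness of the upper bound in the strong sense
    InvMills.S 0 = 1 ∧
    Filter.Tendsto InvMills.S
      (Bornology.cobounded ℂ ⊓ Filter.principal InvMills.Hplus) (nhds 1) := by
  obtain ⟨y₀, hl, hr, h0⟩ := InvMills.exists_slope_eq_zero
  have hy₀ : 0 < y₀ := lt_trans (by norm_num) hl
  obtain ⟨m1, m2⟩ := InvMills.critSq_bounds
  have hm : Real.sqrt InvMills.critSq < y₀ := by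
    rw [Real.sqrt_lt' hy₀]
    have : (1.6267 : ℝ) ^ 2 < y₀ ^ 2 := pow_lt_pow_left₀ hl (by norm_num) two_ne_zero
    norm_num at *; linarith
  obtain ⟨hmono, hanti⟩ := InvMills.sqMod_unimodal
    (lt_trans (by norm_num) m1) (lt_trans m2 (by norm_num)) hm h0
  have hmain : ∀ z ∈ InvMills.Hplus \ {0, Complex.I * (y₀ : ℂ), -(Complex.I * (y₀ : ℂ))},
      ‖InvMills.S z‖ < 1 ∧ ‖InvMills.S (Complex.I * (y₀ : ℂ))‖ < ‖InvMills.S z‖ := by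
    rintro z ⟨hz, hne⟩
    simp only [Set.mem_insert_iff, Set.mem_singleton_iff, not_or] at hne
    exact InvMills.norm_S_mem_Ioo hy₀ hmono hanti hz hne.1 hne.2.1 hne.2.2
  have hsub : ∀ z : ℂ, 0 < z.re →
      z ∈ InvMills.Hplus \ {0, Complex.I * (y₀ : ℂ), -(Complex.I * (y₀ : ℂ))} := by
    refine fun z hz => ⟨hz.le, ?_⟩
    rintro (rfl | rfl | rfl) <;> simp at hz
  have hlt : ∀ y : ℝ, 0 < y → y ≠ y₀ →
      ‖InvMills.S (Complex.I * (y₀ : ℂ))‖ < ‖InvMills.S (Complex.I * (y : ℂ))‖ := by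
    intro y hy hne
    refine (InvMills.norm_S_mem_Ioo hy₀ hmono hanti (by simp [InvMills.Hplus]) ?_ ?_ ?_).2
    · simpa using hy.ne'
    · simpa using hne
    · rw [← mul_neg, ← Complex.ofReal_neg]
      simp only [ne_eq, mul_eq_mul_left_iff, Complex.ofReal_inj, Complex.I_ne_zero, or_false]
      linarith
  refine ⟨⟨InvMills.differentiable_Psi, InvMills.Psi_ofReal⟩, fun z hz => InvMills.Psi_ne_zero hz,
    fun z hz => InvMills.add_sqrt_ne_zero hz, fun z hz =>
      (InvMills.differentiableAt_S (interior_subset hz)).differentiableWithinAt,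
    ⟨y₀, ⟨hy₀, ?_, ?_⟩, ⟨hl.le, hr⟩, InvMills.norm_S_peak_bounds hl hr, hmain,
      InvMills.isGLB_norm_S (by simp) hsub fun z hz => (hmain z hz).2,
      InvMills.isLUB_norm_S hsub fun z hz => (hmain z hz).1⟩, InvMills.S_zero, InvMills.tendsto_S⟩
  · intro y hy
    rcases eq_or_ne y y₀ with rfl | h
    · exact le_refl ‖InvMills.S (Complex.I * (y : ℂ))‖
    · exact (hlt y hy h).le
  · intro y hy hmin
    by_contra h
    exact absurd (hmin (show y₀ ∈ Set.Ioi 0 from hy₀)) (not_le.2 (hlt y hy h))
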